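/- Let $n\ge 1$ and let $M(n,\mathbf H)$ be the ring of $n\times n$ matrices over the real Hamilton quaternions $\mathbf H$. For $\sigma\in S_n$ and an index $i$, write $\sigma$ as a product of $r$ disjoint cycles (fixed points included), $\sigma=c_1c_2\cdots c_r$, so that $c_1$ is the cycle through $i$, written starting with $i$, each of the other cycles is written starting with its smallest element, and these smallest elements increase from $c_2$ to $c_r$. For $A=(a_{pq})\in M(n,\mathbf H)$ and a cycle $c$ that starts with $p$, has length $\ell$ and is contained in $\sigma$, put $a_c=a_{p,\sigma(p)}\,a_{\sigma(p),\sigma^2(p)}\cdots a_{\sigma^{\ell-1}(p),p}$. The $i$th row and column determinants of $A$ are $$\mathrm{rdet}_i A=\sum_{\sigma\in S_n}(-1)^{n-r}a_{c_1}a_{c_2}\cdots a_{c_r},\qquad \mathrm{cdet}_i A=\sum_{\sigma\in S_n}(-1)^{n-r}a_{c_r}\cdots a_{c_2}a_{c_1}.$$ Let $A^*$ be the conjugate transpose of $A$. Then for every $A\in M(n,\mathbf H)$ the quaternions $\mathrm{rdet}_i(AA^*)$, $\mathrm{cdet}_i(AA^*)$, $\mathrm{rdet}_i(A^*A)$, $\mathrm{cdet}_i(A^*A)$,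 $1\le i\le n$, all have the same value, which is called the double determinant $\mathrm{ddet}\,A$ of $A$; and for all $A,B\in M(n,\mathbf H)$, $$\mathrm{ddet}(A\cdot B)=\mathrm{ddet}\,A\cdot\mathrm{ddet}\,B.$$ -/

import Mathlib

namespace RowColDet

open Equiv

variable {n : ℕ}

/-- The product of the entries of `A` along the cycle of `σ` through `i`, read from `i`:
`a_{i, σ i} a_{σ i, σ² i} ⋯ a_{σ⁻¹ i, i}`. A fixed point `i` contributes `a_{i i}`. -/
noncomputable def cycleProd {R : Type*} [Ring R] (A : Matrix (Fin n) (Fin n) R) (σ : Perm (Fin n))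
    (i : Fin n) : R :=
  ((List.range (Function.minimalPeriod σ i)).map
    fun k => A ((σ ^ k) i) ((σ ^ (k + 1)) i)).prod

/-- The first elements of the disjoint cycles of `σ` (fixed points included), in the ordered
cycle notation that begins with the index `i`: first `i` itself, then, in increasing order, the
smallest elements of those cycles that do not contain `i`. -/
def cycleStarts (σ : Perm (Fin n)) (i : Fin n) : List (Fin n) :=
  i :: (List.finRange n).filter fun j => ¬ σ.SameCycle i j ∧ ∀ k, σ.SameCycle j k → j ≤ k

/-- The `i`th row determinant: in each monomial the cycles are multiplied from left to right in
the order `cycleStarts σ i`, so that the cycle through `i` comes first. The sign of `σ` is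
`(-1) ^ (n - r)`, where `r` is the number of its cycles. -/
noncomputable def rdet {R : Type*} [Ring R] (i : Fin n) (A : Matrix (Fin n) (Fin n) R) : R :=
  ∑ σ : Perm (Fin n), ((Perm.sign σ : ℤ) : R) * ((cycleStarts σ i).map (cycleProd A σ)).prod

/-- The `j`th column determinant: in each monomial the cycles are multiplied from right to left
in the order `cycleStarts σ j`, so that the cycle through `j` comes last and the last factor of
the monomial is its entry in the `j`th column. -/
noncomputable def cdet {R : Type*} [Ring R] (j : Fin n) (A : Matrix (Fin n) (Fin n) R) : R :=
  ∑ σ : Perm (Fin n),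
    ((Perm.sign σ : ℤ) : R) * ((cycleStarts σ j).reverse.map (cycleProd A σ)).prod

/-- The determinant of a Hermitian quaternion matrix, as its first row determinant. (All row and
column determinants of a Hermitian matrix coincide.) -/
noncomputable def hermDet [NeZero n] (A : Matrix (Fin n) (Fin n) (Quaternion ℝ)) :
    Quaternion ℝ :=
  rdet 0 A

/-- The double determinant of a square quaternion matrix `A`: the determinant of the Hermitian
matrix `A A*`. -/
noncomputable def ddet [NeZero n] (A : Matrix (Fin n) (Fin n) (Quaternion ℝ)) : Quaternion ℝ :=
  hermDet (A * A.conjTranspose)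

end RowColDet

/-!
Sending a quaternion to a complex `2 × 2` block turns a quaternion matrix `A` into a complex matrix
`χ A`, and for Hermitian `H` the matrix `W = χ H * J`, with `J` the standard symplectic form, is
skew-symmetric. The Pfaffian satisfies `Pf (B * W * Bᵀ) = det B * Pf W`, so
`Pf (χ (A * A*) * J) = det (χ A) * Pf J`, and `det (χ A)` is multiplicative and invariant under
`A ↦ A*`.

Each term of the Pfaffian of `W` is a perfect matching. Its union with the perfect matching `J` is
a union of cycles, which become the cycles of a permutation once they are oriented. Averaging over
the orientations writes the Pfaffian as a sum over permutations `σ` of `sign σ` times the product,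
over the cycles of `σ`, of half the trace of the product of blocks along the cycle; and half the
trace of the block of a quaternion is its real part.

In a row or column determinant of `H`, inverting one cycle of `σ` replaces the product along that
cycle by its conjugate and changes nothing else. Averaging over these inversions replaces every
cycle product by its real part. The order of the factors becomes immaterial, and every row and
column determinant of `H` is equal to the Pfaffian sum.
-/

namespace RowColDet

open Equiv

section Pfaffian

variable {ι R : Type*} [Fintype ι] [DecidableEq ι] [CommRing R]

theorem sum_eq_sum_perm_of_eq_zero {M : Type*} [AddCommMonoid M] (F : (ι → ι) → M)
    (hF : ∀ g, ¬ Function.Injective g → F g = 0) : ∑ g, F g = ∑ τ : Perm ι, F τ := by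
  refine (Fintype.sum_of_injective (fun τ : Perm ι => ⇑τ) DFunLike.coe_injective _ _
    (fun g hg => hF g fun hinj => hg ?_) fun _ => rfl).symm
  exact ⟨Equiv.ofBijective g (Finite.injective_iff_bijective.1 hinj), rfl⟩

theorem det_submatrix_id_eq_zero (B : Matrix ι ι R) {g : ι → ι} (hg : ¬ Function.Injective g) :
    (B.submatrix id g).det = 0 := by
  obtain ⟨i, j, hij, hne⟩ := Function.not_injective_iff.1 hg
  exact Matrix.det_zero_of_column_eq hne fun k => by rw [Matrix.submatrix_apply, hij]; rfl

/-- The term of a permutation in the Pfaffian of a matrix indexed by `ι × Bool`: the permutation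
`τ` stands for the perfect matching of `ι × Bool` with the edges `{τ (k, false), τ (k, true)}`. -/
def pfaffianTerm (W : Matrix (ι × Bool) (ι × Bool) R) (τ : Perm (ι × Bool)) : R :=
  ((Perm.sign τ : ℤ) : R) * ∏ k, W (τ (k, false)) (τ (k, true))

/-- The Pfaffian of a matrix indexed by `ι × Bool`, without the usual factor `1 / (2 ^ n * n!)`,
where `n` is the cardinality of `ι`: every perfect matching is counted once for each permutation
that represents it. -/
def scaledPfaffian (W : Matrix (ι × Bool) (ι × Bool) R) : R :=
  ∑ τ, pfaffianTerm W τ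

theorem mul_mul_transpose_apply_eq_sum_bool {κ : Type*} [Fintype κ] (B W : Matrix κ κ R)
    (a b : κ) : (B * W * B.transpose) a b =
      ∑ c : Bool → κ, W (c false) (c true) * (B a (c false) * B b (c true)) := by
  rw [← (Equiv.boolArrowEquivProd _).symm.sum_comp, Fintype.sum_prod_type_right, Matrix.mul_apply]
  simp only [Matrix.mul_apply, Matrix.transpose_apply, Finset.sum_mul]
  refine Finset.sum_congr rfl fun c _ => Finset.sum_congr rfl fun d _ => ?_
  change B a d * W d c * B b c = W d c * (B a d * B b c)
  ring

theorem prod_mul_mul_transpose_apply (B W : Matrix (ι × Bool) (ι × Bool) R)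
    (τ : ι × Bool → ι × Bool) :
    ∏ k, (B * W * B.transpose) (τ (k, false)) (τ (k, true)) =
      ∑ g : ι × Bool → ι × Bool, (∏ k, W (g (k, false)) (g (k, true))) * ∏ x, B (τ x) (g x) := by
  simp_rw [mul_mul_transpose_apply_eq_sum_bool]
  rw [Finset.prod_univ_sum, Fintype.piFinset_univ, ← (Equiv.curry ι Bool (ι × Bool)).sum_comp]
  refine Finset.sum_congr rfl fun g _ => ?_
  rw [Finset.prod_mul_distrib, Fintype.prod_prod_type]
  simp only [Fintype.prod_bool, Equiv.curry_apply, Function.curry, mul_comm]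

theorem scaledPfaffian_mul_mul_transpose (B W : Matrix (ι × Bool) (ι × Bool) R) :
    scaledPfaffian (B * W * B.transpose) = B.det * scaledPfaffian W := by
  calc scaledPfaffian (B * W * B.transpose)
      = ∑ g : ι × Bool → ι × Bool, (∏ k, W (g (k, false)) (g (k, true))) *
          (B.submatrix id g).det := by
        simp_rw [scaledPfaffian, pfaffianTerm, prod_mul_mul_transpose_apply, Matrix.det_apply',
          Finset.mul_sum, mul_left_comm]
        exact Finset.sum_comm
    _ = ∑ τ : Perm (ι × Bool), (∏ k, W (τ (k, false)) (τ (k, true))) *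
          (B.submatrix id τ).det :=
        sum_eq_sum_perm_of_eq_zero _ fun g hg => by rw [det_submatrix_id_eq_zero B hg, mul_zero]
    _ = B.det * scaledPfaffian W := by
        simp_rw [scaledPfaffian, pfaffianTerm, Finset.mul_sum, Matrix.det_permute']
        exact Finset.sum_congr rfl fun τ _ => by ring

end Pfaffian

section Layers

variable {ι : Type*}

/-- The permutation of `ι × Bool` that flips the second component over `{k | s k = true}`. -/
def flipBy (s : ι → Bool) : Perm (ι × Bool) :=
  prodCongrRight fun k => if s k then Equiv.boolNot else 1

/-- The permutation of `ι × Bool` that acts as `π` on `ι × {false}` and as `ρ` on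
`ι × {true}`. -/
def layered (π ρ : Perm ι) : Perm (ι × Bool) :=
  prodCongrLeft fun b => if b then ρ else π

@[simp]
theorem flipBy_apply (s : ι → Bool) (x : ι × Bool) : flipBy s x = (x.1, x.2 ^^ s x.1) := by
  obtain ⟨k, b⟩ := x
  cases h : s k <;> simp [flipBy, h]

theorem flipBy_mul_self (s : ι → Bool) : flipBy s * flipBy s = 1 := by
  ext x <;> simp

@[simp]
theorem layered_apply_false (π ρ : Perm ι) (k : ι) : layered π ρ (k, false) = (π k, false) := rfl

@[simp]
theorem layered_apply_true (π ρ : Perm ι) (k : ι) : layered π ρ (k, true) = (ρ k, true) := rfl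

theorem layered_mul (π ρ π' ρ' : Perm ι) :
    layered π ρ * layered π' ρ' = layered (π * π') (ρ * ρ') := by
  ext ⟨k, b⟩ <;> cases b <;> simp

theorem layered_injective :
    Function.Injective fun p : Perm ι × Perm ι => layered p.1 p.2 := by
  rintro ⟨π, ρ⟩ ⟨π', ρ'⟩ h
  have h' := fun x => congrArg (fun e : Perm (ι × Bool) => e x) h
  refine Prod.ext (Equiv.ext fun k => ?_) (Equiv.ext fun k => ?_)
  · simpa using h' (k, false)
  · simpa using h' (k, true)

theorem exists_eq_layered {τ : Perm (ι × Bool)} (h : ∀ x, (τ x).2 = x.2) :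
    ∃ π ρ, τ = layered π ρ := by
  have h_symm : ∀ x, (τ.symm x).2 = x.2 := fun x => by simpa [eq_comm] using h (τ.symm x)
  have mk_apply : ∀ b k, ((τ (k, b)).1, b) = τ (k, b) := fun b k => Prod.ext rfl (h (k, b)).symm
  have mk_symm_apply : ∀ b k, ((τ.symm (k, b)).1, b) = τ.symm (k, b) :=
    fun b k => Prod.ext rfl (h_symm (k, b)).symm
  let layer (b : Bool) : Perm ι := ⟨fun k => (τ (k, b)).1, fun k => (τ.symm (k, b)).1,
    fun k => by simp only [mk_apply, symm_apply_apply],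
    fun k => by simp only [mk_symm_apply, apply_symm_apply]⟩
  refine ⟨layer false, layer true, Equiv.ext ?_⟩
  rintro ⟨k, _ | _⟩
  · exact (mk_apply false k).symm
  · exact (mk_apply true k).symm

variable [Fintype ι] [DecidableEq ι]

theorem sign_flipBy (s : ι → Bool) :
    Perm.sign (flipBy s) = ∏ k, if s k then -1 else 1 := by
  have sign_boolNot : Perm.sign Equiv.boolNot = -1 := by decide
  simp_rw [flipBy, Perm.sign_prodCongrRight, apply_ite, sign_boolNot, Perm.sign_one]

theorem sign_layered (π ρ : Perm ι) :
    Perm.sign (layered π ρ) = Perm.sign π * Perm.sign ρ := by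
  rw [layered, Perm.sign_prodCongrLeft, Fintype.prod_bool, mul_comm]
  rfl

theorem intCast_sign_flipBy {R : Type*} [CommRing R] (s : ι → Bool) :
    ((Perm.sign (flipBy s) : ℤ) : R) = ∏ k, if s k then -1 else 1 := by
  rw [sign_flipBy, Units.coe_prod, Int.cast_prod]
  exact Finset.prod_congr rfl fun k _ => by split_ifs <;> simp

theorem intCast_sign_flipBy_mul_self {R : Type*} [CommRing R] (s : ι → Bool) :
    ((Perm.sign (flipBy s) : ℤ) : R) * ((Perm.sign (flipBy s) : ℤ) : R) = 1 := by
  rw [← Int.cast_mul, ← Units.val_mul, Int.units_mul_self, Units.val_one, Int.cast_one]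

end Layers

section Orientations

variable {ι : Type*}

theorem exists_injective_fst_apply (τ : Perm (ι × Bool)) :
    ∃ e : ι → Bool, Function.Injective fun k => (τ (k, e k)).1 := by
  classical
  let t (k : ι) : Finset ι := Finset.univ.image fun b => (τ (k, b)).1
  have hall : ∀ S : Finset ι, S.card ≤ (S.biUnion t).card := by
    intro S
    have hle : (S ×ˢ (Finset.univ : Finset Bool)).card ≤
        (S.biUnion t ×ˢ (Finset.univ : Finset Bool)).card := by
      refine Finset.card_le_card_of_injOn τ (fun x hx => ?_) τ.injective.injOn
      have hx' : x.1 ∈ S := by simpa using hx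
      have hτx : (τ x).1 ∈ S.biUnion t :=
        Finset.mem_biUnion.2 ⟨x.1, hx', Finset.mem_image.2 ⟨x.2, Finset.mem_univ _, rfl⟩⟩
      simpa using hτx
    simpa [Finset.card_product] using hle
  obtain ⟨f, hf, hft⟩ := (Finset.all_card_le_biUnion_card_iff_exists_injective t).1 hall
  choose e _ he using fun k => Finset.mem_image.1 (hft k)
  exact ⟨e, by simpa only [he] using hf⟩

variable [Fintype ι] [DecidableEq ι]

/-- The pairs `(s, e)` such that `flipBy s * τ * flipBy e` preserves the second component, that
is, is `layered`. -/
def orientations (τ : Perm (ι × Bool)) : Finset ((ι → Bool) × (ι → Bool)) :=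
  {p | ∀ x, (flipBy p.1 (τ x)).2 = (flipBy p.2 x).2}

theorem mem_orientations {τ : Perm (ι × Bool)} {s e : ι → Bool} :
    (s, e) ∈ orientations τ ↔ ∀ x, ((τ x).2 ^^ s (τ x).1) = (x.2 ^^ e x.1) := by
  simp [orientations]

/-- The Hall transversal picks one endpoint of every edge of the matching `τ`, and these endpoints
lie over distinct elements of `ι`; the second endpoints are then the complementary ones. -/
theorem orientations_nonempty (τ : Perm (ι × Bool)) : (orientations τ).Nonempty := by
  obtain ⟨e, he⟩ := exists_injective_fst_apply τ
  let f : Perm ι := Equiv.ofBijective _ (Finite.injective_iff_bijective.1 he)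
  have fst_apply : ∀ k, (τ (k, e k)).1 = f k := fun _ => rfl
  refine ⟨(fun j => (τ (f.symm j, e (f.symm j))).2, e), mem_orientations.2 ?_⟩
  rintro ⟨k, b⟩
  by_cases hb : b = e k
  · subst hb
    simp [fst_apply]
  · set j := f.symm (τ (k, b)).1 with hj
    have hne : (τ (k, b)).2 ≠ (τ (j, e j)).2 := by
      intro heq
      have hτ : τ (k, b) = τ (j, e j) := Prod.ext (by rw [fst_apply, hj, apply_symm_apply]) heq
      have hkj := Prod.ext_iff.1 (τ.injective hτ)
      exact hb (hkj.2.trans (congrArg e hkj.1.symm))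
    rw [Bool.eq_not.2 hne, Bool.eq_not.2 hb, Bool.not_xor_self, Bool.not_xor_self]

theorem card_orientations_flipBy_mul (s e : ι → Bool) (τ : Perm (ι × Bool)) :
    (orientations (flipBy s * τ * flipBy e)).card = (orientations τ).card := by
  have mem_iff : ∀ s' e' : ι → Bool, (s', e') ∈ orientations (flipBy s * τ * flipBy e) ↔
      ((fun k => s k ^^ s' k), fun k => e k ^^ e' k) ∈ orientations τ := by
    intro s' e'
    rw [mem_orientations, mem_orientations, ← (flipBy e).forall_congr_right]
    refine forall_congr' fun x => ?_
    have : flipBy e (flipBy e x) = x := by rw [← Perm.mul_apply, flipBy_mul_self, Perm.one_apply]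
    simp only [Perm.mul_apply, this]
    simp only [flipBy_apply, Bool.xor_assoc]
  refine Finset.card_bij (fun p _ => ((fun k => s k ^^ p.1 k), fun k => e k ^^ p.2 k))
    (fun p hp => (mem_iff _ _).1 hp) ?_ ?_
  · rintro ⟨a, b⟩ _ ⟨a', b'⟩ _ h
    simpa [funext_iff] using h
  · rintro ⟨a, b⟩ h
    exact ⟨((fun k => s k ^^ a k), fun k => e k ^^ b k), (mem_iff _ _).2 (by simpa using h),
      by simp⟩

/-- The number of two-colourings that are constant on the cycles of `σ`, which is `2 ^ r` if `σ`
has `r` cycles. -/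
def cycleColouringCount (σ : Perm ι) : ℕ :=
  (Finset.univ.filter fun s : ι → Bool => ∀ k, s (σ k) = s k).card

theorem mem_orientations_layered {π ρ : Perm ι} {s e : ι → Bool} :
    (s, e) ∈ orientations (layered π ρ) ↔
      (∀ k, s ((ρ * π⁻¹) k) = s k) ∧ e = fun k => s (π k) := by
  rw [mem_orientations, funext_iff, ← π.forall_congr_right (q := fun k => s ((ρ * π⁻¹) k) = s k)]
  simp only [Prod.forall, Bool.forall_bool, layered_apply_false, layered_apply_true,
    Perm.mul_apply, Perm.inv_def, Equiv.symm_apply_apply, Bool.false_xor, Bool.true_xor,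
    Bool.not_inj_iff]
  constructor
  · exact fun h => ⟨fun k => (h k).2.trans (h k).1.symm, fun k => (h k).1.symm⟩
  · exact fun h k => ⟨(h.2 k).symm, (h.1 k).trans (h.2 k).symm⟩

theorem card_orientations_layered (π ρ : Perm ι) :
    (orientations (layered π ρ)).card = cycleColouringCount (ρ * π⁻¹) := by
  refine Finset.card_bij (fun p _ => p.1) (fun p hp => ?_) ?_ ?_
  · exact Finset.mem_filter.2 ⟨Finset.mem_univ _, (mem_orientations_layered.1 hp).1⟩
  · rintro ⟨s, e⟩ h ⟨s', e'⟩ h' rfl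
    rw [(mem_orientations_layered.1 h).2, (mem_orientations_layered.1 h').2]
  · intro s hs
    exact ⟨(s, fun k => s (π k)),
      mem_orientations_layered.2 ⟨(Finset.mem_filter.1 hs).2, rfl⟩, rfl⟩

theorem mem_orientations_iff_exists_layered {τ : Perm (ι × Bool)} {s e : ι → Bool} :
    (s, e) ∈ orientations τ ↔ ∃ π ρ, flipBy s * layered π ρ * flipBy e = τ := by
  constructor
  · intro h
    obtain ⟨π, ρ, hπρ⟩ := exists_eq_layered (τ := flipBy s * τ * flipBy e) fun x => by
      have hx := mem_orientations.1 h (flipBy e x)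
      simp only [flipBy_apply, Bool.xor_assoc, Bool.xor_self, Bool.xor_false] at hx
      simp only [Perm.mul_apply, flipBy_apply, hx]
    refine ⟨π, ρ, ?_⟩
    rw [← hπρ, mul_assoc, mul_assoc, mul_assoc, flipBy_mul_self, mul_one, ← mul_assoc,
      flipBy_mul_self, one_mul]
  · rintro ⟨π, ρ, rfl⟩
    rw [mem_orientations]
    rintro ⟨k, b⟩
    cases b <;> cases h : e k <;> simp [h]

theorem sum_filter_mem_orientations {M : Type*} [AddCommMonoid M] (s e : ι → Bool)
    (F : Perm (ι × Bool) → M) :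
    ∑ τ with (s, e) ∈ orientations τ, F τ =
      ∑ p : Perm ι × Perm ι, F (flipBy s * layered p.1 p.2 * flipBy e) := by
  symm
  refine Finset.sum_bij (fun p _ => flipBy s * layered p.1 p.2 * flipBy e) ?_ ?_ ?_
    fun _ _ => rfl
  · intro p _
    exact Finset.mem_filter.2 ⟨Finset.mem_univ _,
      mem_orientations_iff_exists_layered.2 ⟨p.1, p.2, rfl⟩⟩
  · intro p _ p' _ h
    exact layered_injective (mul_left_cancel (mul_right_cancel h))
  · intro τ hτ
    obtain ⟨π, ρ, h⟩ := mem_orientations_iff_exists_layered.1 (Finset.mem_filter.1 hτ).2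
    exact ⟨(π, ρ), Finset.mem_univ _, h⟩

theorem sum_perm_eq_sum_layered {K : Type*} [DivisionRing K] [CharZero K]
    (F : Perm (ι × Bool) → K) :
    ∑ τ, F τ = ∑ p : (ι → Bool) × (ι → Bool), ∑ q : Perm ι × Perm ι,
      (cycleColouringCount (q.2 * q.1⁻¹) : K)⁻¹ *
        F (flipBy p.1 * layered q.1 q.2 * flipBy p.2) := by
  have average : ∀ τ, F τ = ∑ p with p ∈ orientations τ, ((orientations τ).card : K)⁻¹ * F τ := by
    intro τ
    have hcard : ((orientations τ).card : K) ≠ 0 :=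
      Nat.cast_ne_zero.2 (Finset.card_ne_zero.2 (orientations_nonempty τ))
    rw [Finset.filter_mem_eq_inter, Finset.univ_inter, Finset.sum_const, nsmul_eq_mul,
      mul_inv_cancel_left₀ hcard]
  calc ∑ τ, F τ
      = ∑ τ, ∑ p with p ∈ orientations τ, ((orientations τ).card : K)⁻¹ * F τ :=
        Finset.sum_congr rfl fun τ _ => average τ
    _ = ∑ p, ∑ τ with p ∈ orientations τ, ((orientations τ).card : K)⁻¹ * F τ := by
        simp_rw [Finset.sum_filter]
        exact Finset.sum_comm
    _ = _ := by
        simp_rw [sum_filter_mem_orientations, card_orientations_flipBy_mul,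
          card_orientations_layered]

end Orientations

section HalfTraceDet

variable {ι : Type*} [DecidableEq ι]

section CommRing

variable {R : Type*} [CommRing R]

variable (ι R) in
/-- The standard symplectic form on `ι × Bool`, with the block `!![0, 1; -1, 0]` at every diagonal
position. -/
def symplecticMatrix : Matrix (ι × Bool) (ι × Bool) R :=
  Matrix.of fun x y => if x = (y.1, !y.2) then (if y.2 then 1 else -1) else 0

theorem transpose_symplecticMatrix : (symplecticMatrix ι R).transpose = -symplecticMatrix ι R := by
  ext ⟨j, a⟩ ⟨k, b⟩
  by_cases h : j = k <;> cases a <;> cases b <;> simp [symplecticMatrix, h, Ne.symm]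

variable [Fintype ι]

theorem mul_symplecticMatrix_apply (Y : Matrix (ι × Bool) (ι × Bool) R) (x y : ι × Bool) :
    (Y * symplecticMatrix ι R) x y = (if y.2 then 1 else -1) * Y x (y.1, !y.2) := by
  simp [Matrix.mul_apply, symplecticMatrix]

theorem symplecticMatrix_mul_apply (Y : Matrix (ι × Bool) (ι × Bool) R) (x y : ι × Bool) :
    (symplecticMatrix ι R * Y) x y = (if x.2 then -1 else 1) * Y (x.1, !x.2) y := by
  rw [← Matrix.transpose_apply (symplecticMatrix ι R * Y), Matrix.transpose_mul,
    transpose_symplecticMatrix, Matrix.mul_neg, Matrix.neg_apply, mul_symplecticMatrix_apply]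
  cases x.2 <;> simp

theorem symplecticMatrix_mul_self : symplecticMatrix ι R * symplecticMatrix ι R = -1 := by
  ext ⟨j, a⟩ ⟨k, b⟩
  rw [mul_symplecticMatrix_apply]
  by_cases h : j = k <;> cases a <;> cases b <;> simp [symplecticMatrix, h]

theorem isUnit_det_symplecticMatrix : IsUnit (symplecticMatrix ι R).det := by
  rw [← Matrix.isUnit_iff_isUnit_det]
  exact .of_mul_eq_one (-symplecticMatrix ι R)
    (by rw [Matrix.mul_neg, symplecticMatrix_mul_self, neg_neg])

variable {W : Matrix (ι × Bool) (ι × Bool) R}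

theorem pfaffianTerm_mul_flipBy (hW : W.transpose = -W) (τ : Perm (ι × Bool)) (e : ι → Bool) :
    pfaffianTerm W (τ * flipBy e) = pfaffianTerm W τ := by
  have skew : ∀ x y, W x y = -W y x := fun x y => congrFun₂ hW y x
  have flip_edge : ∀ k, W ((τ * flipBy e) (k, false)) ((τ * flipBy e) (k, true)) =
      (if e k then -1 else 1) * W (τ (k, false)) (τ (k, true)) := by
    intro k
    cases hk : e k
    · simp [hk]
    · simp [hk, ← skew]
  simp_rw [pfaffianTerm, flip_edge, Finset.prod_mul_distrib, ← intCast_sign_flipBy,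
    Perm.sign_mul, Units.val_mul, Int.cast_mul]
  rw [mul_assoc, ← mul_assoc _ _ (∏ k, _), intCast_sign_flipBy_mul_self, one_mul]

theorem pfaffianTerm_mul_layered_self (τ : Perm (ι × Bool)) (π : Perm ι) :
    pfaffianTerm W (τ * layered π π) = pfaffianTerm W τ := by
  simp only [pfaffianTerm, Perm.sign_mul, sign_layered, Int.units_mul_self, mul_one,
    Perm.mul_apply, layered_apply_false, layered_apply_true]
  rw [Equiv.prod_comp π fun k => W (τ (k, false)) (τ (k, true))]

theorem pfaffianTerm_flipBy_mul_layered_one (Y : Matrix (ι × Bool) (ι × Bool) R) (s : ι → Bool)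
    (σ : Perm ι) : pfaffianTerm (Y * symplecticMatrix ι R) (flipBy s * layered 1 σ) =
      ((Perm.sign σ : ℤ) : R) * ∏ k, Y (k, s k) (σ k, s (σ k)) := by
  have edge : ∀ k, (Y * symplecticMatrix ι R) ((flipBy s * layered 1 σ) (k, false))
      ((flipBy s * layered 1 σ) (k, true)) =
        (if s (σ k) then -1 else 1) * Y (k, s k) (σ k, s (σ k)) := by
    intro k
    cases h : s (σ k) <;> simp [h, mul_symplecticMatrix_apply]
  simp_rw [pfaffianTerm, edge, Finset.prod_mul_distrib]
  rw [Equiv.prod_comp σ fun k => if s k then (-1 : R) else 1, ← intCast_sign_flipBy,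
    Perm.sign_mul, sign_layered, Perm.sign_one, one_mul, Units.val_mul, Int.cast_mul,
    mul_comm (Int.cast _), mul_assoc, ← mul_assoc _ _ (∏ k, _), intCast_sign_flipBy_mul_self,
    one_mul]

end CommRing

variable [Fintype ι] {K : Type*} [Field K]

/-- The sum over all `σ` of `sign σ` times the product, over the cycles of `σ`, of half the trace
of the product of the two-by-two blocks of `Y` along the cycle. The traces are expanded into a sum
over the two-colourings of `ι`. -/
def halfTraceDet (Y : Matrix (ι × Bool) (ι × Bool) K) : K :=
  ∑ σ : Perm ι, ((Perm.sign σ : ℤ) : K) * (cycleColouringCount σ : K)⁻¹ *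
    ∑ s : ι → Bool, ∏ k, Y (k, s k) (σ k, s (σ k))

theorem halfTraceDet_one [CharZero K] :
    halfTraceDet (1 : Matrix (ι × Bool) (ι × Bool) K) = 1 := by
  rw [halfTraceDet, Finset.sum_eq_single 1]
  · have diagonal : ∀ s : ι → Bool, ∏ k, (1 : Matrix (ι × Bool) (ι × Bool) K) (k, s k)
        ((1 : Perm ι) k, s ((1 : Perm ι) k)) = 1 :=
      fun s => Finset.prod_eq_one fun k _ => Matrix.one_apply_eq _
    simp_rw [diagonal]
    simp [cycleColouringCount]
  · intro σ _ hσ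
    obtain ⟨k, hk⟩ : ∃ k, σ k ≠ k := by
      by_contra! h
      exact hσ (Equiv.ext h)
    refine mul_eq_zero_of_right _ (Finset.sum_eq_zero fun s _ =>
      Finset.prod_eq_zero (Finset.mem_univ k) (Matrix.one_apply_ne fun h => hk ?_))
    exact (congrArg Prod.fst h).symm
  · simp

theorem sum_mul_inv_eq_card_nsmul_sum {G M : Type*} [Group G] [Fintype G] [AddCommMonoid M]
    (f : G → M) : ∑ q : G × G, f (q.2 * q.1⁻¹) = Fintype.card G • ∑ g, f g :=
  calc ∑ q : G × G, f (q.2 * q.1⁻¹)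
      = ∑ _g : G, ∑ g, f g := by
        rw [Fintype.sum_prod_type]
        exact Finset.sum_congr rfl fun h _ => Equiv.sum_comp (Equiv.mulRight h⁻¹) f
    _ = Fintype.card G • ∑ g, f g := by rw [Finset.sum_const, Finset.card_univ]

theorem scaledPfaffian_mul_symplecticMatrix [CharZero K] {Y : Matrix (ι × Bool) (ι × Bool) K}
    (hY : (Y * symplecticMatrix ι K).transpose = -(Y * symplecticMatrix ι K)) :
    scaledPfaffian (Y * symplecticMatrix ι K) =
      (Fintype.card ((ι → Bool) × Perm ι) : K) * halfTraceDet Y := by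
  set W := Y * symplecticMatrix ι K
  have summand : ∀ (s e : ι → Bool) (π ρ : Perm ι),
      pfaffianTerm W (flipBy s * layered π ρ * flipBy e) =
        pfaffianTerm W (flipBy s * layered 1 (ρ * π⁻¹)) := by
    intro s e π ρ
    have hπρ : layered π ρ = layered 1 (ρ * π⁻¹) * layered π π := by
      rw [layered_mul, one_mul, inv_mul_cancel_right]
    rw [pfaffianTerm_mul_flipBy hY, hπρ, ← mul_assoc, pfaffianTerm_mul_layered_self]
  let G (s : ι → Bool) (σ : Perm ι) : K :=
    (cycleColouringCount σ : K)⁻¹ * pfaffianTerm W (flipBy s * layered 1 σ)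
  calc scaledPfaffian W
      = ∑ p : (ι → Bool) × (ι → Bool), ∑ q : Perm ι × Perm ι, G p.1 (q.2 * q.1⁻¹) := by
        simp_rw [scaledPfaffian, sum_perm_eq_sum_layered (pfaffianTerm W), summand, G]
    _ = (Fintype.card (ι → Bool) : K) * ((Fintype.card (Perm ι) : K) * ∑ s, ∑ σ, G s σ) := by
        simp_rw [sum_mul_inv_eq_card_nsmul_sum, Fintype.sum_prod_type_right, Finset.sum_const,
          Finset.card_univ, nsmul_eq_mul, Finset.mul_sum]
    _ = (Fintype.card ((ι → Bool) × Perm ι) : K) * halfTraceDet Y := by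
        simp_rw [G, W, pfaffianTerm_flipBy_mul_layered_one, mul_left_comm (_⁻¹)]
        rw [halfTraceDet, Finset.sum_comm, Fintype.card_prod, Nat.cast_mul, mul_assoc]
        simp_rw [Finset.mul_sum, mul_assoc]

end HalfTraceDet

section CyclicWords

variable {β R : Type*} [Fintype β] [DecidableEq β] [CommRing R]

theorem list_prod_map_range_apply (x : ℕ → Matrix β β R) (m : ℕ) (a b : β) :
    ((List.range m).map x).prod a b = ∑ s : Fin (m + 1) → β,
      if s 0 = a ∧ s (Fin.last m) = b then ∏ k : Fin m, x k (s k.castSucc) (s k.succ) else 0 := by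
  induction m generalizing b with
  | zero =>
    rw [← (Equiv.funUnique (Fin 1) β).symm.sum_comp]
    simp [Matrix.one_apply, ite_and]
  | succ m ih =>
    let snoc (c : β) (s : Fin (m + 1) → β) : Fin (m + 2) → β := Fin.snocEquiv (fun _ => β) (c, s)
    have snoc_castSucc : ∀ c s k, snoc c s (Fin.castSucc k) = s k := fun c s k =>
      Fin.snoc_castSucc (α := fun _ => β) c s k
    have snoc_zero : ∀ c s, snoc c s 0 = s 0 := fun c s => snoc_castSucc c s 0
    have snoc_last : ∀ c s, snoc c s (Fin.last _) = c := fun c s =>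
      Fin.snoc_last (α := fun _ => β) c s
    rw [List.range_succ, List.map_append, List.prod_append, Matrix.mul_apply,
      ← (Fin.snocEquiv fun _ => β).sum_comp, Fintype.sum_prod_type_right]
    simp_rw [ih, Finset.sum_mul]
    rw [Finset.sum_comm]
    refine Finset.sum_congr rfl fun s _ => ?_
    change _ = ∑ c, if snoc c s 0 = a ∧ snoc c s (Fin.last _) = b then
      ∏ k : Fin (m + 1), x k (snoc c s k.castSucc) (snoc c s k.succ) else 0
    simp_rw [Fin.prod_univ_castSucc, snoc_zero, snoc_last, ← Fin.castSucc_succ, snoc_castSucc,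
      Fin.succ_last, snoc_last, ite_and]
    by_cases ha : s 0 = a <;> simp [ha]

theorem trace_list_prod_map_range (x : ℕ → Matrix β β R) (m : ℕ) [NeZero m] :
    (((List.range m).map x).prod).trace =
      ∑ s : Fin m → β, ∏ k : Fin m, x k (s k) (s (k + 1)) := by
  obtain _ | m := m
  · exact absurd rfl (NeZero.ne 0)
  calc (((List.range (m + 1)).map x).prod).trace
      = ∑ a, ∑ c, ∑ s : Fin (m + 1) → β, (if s 0 = a ∧ s (Fin.last m) = c then
          ∏ k : Fin m, x k (s k.castSucc) (s k.succ) else 0) * x m c a := by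
        simp_rw [List.range_succ, List.map_append, List.prod_append, Matrix.trace,
          Matrix.diag_apply, Matrix.mul_apply, list_prod_map_range_apply, Finset.sum_mul,
          List.map_singleton, List.prod_singleton]
    _ = ∑ s : Fin (m + 1) → β, ∑ a, ∑ c, (if s 0 = a ∧ s (Fin.last m) = c then
          ∏ k : Fin m, x k (s k.castSucc) (s k.succ) else 0) * x m c a :=
        (Finset.sum_congr rfl fun a _ => Finset.sum_comm).trans Finset.sum_comm
    _ = ∑ s : Fin (m + 1) → β, ∏ k : Fin (m + 1), x k (s k) (s (k + 1)) :=
        Finset.sum_congr rfl fun s _ => by simp [ite_and, Fin.prod_univ_castSucc]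

end CyclicWords

section CycleReps

open Function (minimalPeriod)

variable {ι : Type*}

/-- The list `L` contains exactly one element of each cycle of `σ`, and no element twice. Fixed
points count as cycles. -/
structure IsCycleReps (σ : Perm ι) (L : List ι) : Prop where
  nodup : L.Nodup
  eq_of_sameCycle : ∀ {j k}, j ∈ L → k ∈ L → σ.SameCycle j k → j = k
  exists_sameCycle : ∀ x, ∃ j ∈ L, σ.SameCycle j x

theorem IsCycleReps.reverse {σ : Perm ι} {L : List ι} (h : IsCycleReps σ L) :
    IsCycleReps σ L.reverse where
  nodup := List.nodup_reverse.2 h.nodup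
  eq_of_sameCycle hj hk := h.eq_of_sameCycle (List.mem_reverse.1 hj) (List.mem_reverse.1 hk)
  exists_sameCycle x := by simpa only [List.mem_reverse] using h.exists_sameCycle x

theorem minimalPeriod_perm_pos [Finite ι] (σ : Perm ι) (i : ι) : 0 < minimalPeriod σ i :=
  Function.minimalPeriod_pos_of_mem_periodicPts (σ.injective.mem_periodicPts i)

instance neZero_minimalPeriod_perm [Finite ι] (σ : Perm ι) (i : ι) :
    NeZero (minimalPeriod σ i) :=
  ⟨(minimalPeriod_perm_pos σ i).ne'⟩

theorem pow_mod_minimalPeriod_apply (σ : Perm ι) (i : ι) (k : ℕ) :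
    (σ ^ (k % minimalPeriod σ i)) i = (σ ^ k) i := by
  simpa only [Perm.iterate_eq_pow] using Function.iterate_mod_minimalPeriod_eq (f := σ) (x := i)

theorem pow_minimalPeriod_apply (σ : Perm ι) (i : ι) : (σ ^ minimalPeriod σ i) i = i := by
  simpa only [Perm.iterate_eq_pow] using Function.iterate_minimalPeriod (f := σ) (x := i)

variable [DecidableEq ι] {σ : Perm ι} {L : List ι}

section Finite

variable [Finite ι]

theorem IsCycleReps.bijective_pow_apply (h : IsCycleReps σ L) :
    Function.Bijective fun p : (Σ j : {j // j ∈ L.toFinset}, Fin (minimalPeriod σ j)) =>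
      (σ ^ (p.2 : ℕ)) p.1 := by
  constructor
  · rintro ⟨⟨j, hj⟩, k⟩ ⟨⟨j', hj'⟩, k'⟩ hp
    dsimp only at hp
    obtain rfl : j = j' := by
      refine h.eq_of_sameCycle (List.mem_toFinset.1 hj) (List.mem_toFinset.1 hj') ?_
      rw [← Perm.sameCycle_pow_right (n := (k' : ℕ)), ← hp]
      exact Perm.SameCycle.rfl.pow_right
    rw [← Perm.iterate_eq_pow, ← Perm.iterate_eq_pow] at hp
    have hk : k = k' :=
      Fin.ext ((Function.iterate_eq_iterate_iff_of_lt_minimalPeriod k.2 k'.2).1 hp)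
    rw [hk]
  · intro x
    obtain ⟨j, hj, hx⟩ := h.exists_sameCycle x
    obtain ⟨k, hk⟩ := hx.exists_nat_pow_eq
    exact ⟨⟨⟨j, List.mem_toFinset.2 hj⟩, ⟨k % minimalPeriod σ j,
      Nat.mod_lt _ (minimalPeriod_perm_pos σ j)⟩⟩, (pow_mod_minimalPeriod_apply σ j k).trans hk⟩

/-- The decomposition of `ι` into the cycles of `σ`: each element is `(σ ^ k) j` for exactly one
representative `j` and one `k` less than the length of the cycle of `j`. -/
noncomputable def IsCycleReps.cycleEquiv (h : IsCycleReps σ L) :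
    (Σ j : {j // j ∈ L.toFinset}, Fin (minimalPeriod σ j)) ≃ ι :=
  Equiv.ofBijective _ h.bijective_pow_apply

theorem IsCycleReps.cycleEquiv_apply (h : IsCycleReps σ L) (j : {j // j ∈ L.toFinset})
    (k : Fin (minimalPeriod σ j)) : h.cycleEquiv ⟨j, k⟩ = (σ ^ (k : ℕ)) j := rfl

theorem IsCycleReps.apply_cycleEquiv (h : IsCycleReps σ L) (j : {j // j ∈ L.toFinset})
    (k : Fin (minimalPeriod σ j)) : σ (h.cycleEquiv ⟨j, k⟩) = h.cycleEquiv ⟨j, k + 1⟩ := by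
  rw [h.cycleEquiv_apply, h.cycleEquiv_apply, Fin.val_add, Fin.val_one', Nat.add_mod_mod,
    pow_mod_minimalPeriod_apply, pow_succ', Perm.mul_apply]

end Finite

variable [Fintype ι] {β R : Type*} [Fintype β] [DecidableEq β] [CommRing R]

theorem IsCycleReps.sum_prod_eq_prod_trace (h : IsCycleReps σ L) (x : ι → Matrix β β R) :
    ∑ s : ι → β, ∏ k, x k (s k) (s (σ k)) =
      (L.map fun j => (((List.range (minimalPeriod σ j)).map
        fun k => x ((σ ^ k) j)).prod).trace).prod := by
  let e : ((j : {j // j ∈ L.toFinset}) → Fin (minimalPeriod σ j) → β) ≃ (ι → β) :=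
    (Equiv.piCurry fun _ _ => β).symm.trans (h.cycleEquiv.arrowCongr (Equiv.refl β))
  have e_apply : ∀ c j k, e c (h.cycleEquiv ⟨j, k⟩) = c j k := by
    intro c j k
    change Sigma.uncurry c (h.cycleEquiv.symm _) = _
    rw [Equiv.symm_apply_apply]
    rfl
  calc ∑ s : ι → β, ∏ k, x k (s k) (s (σ k))
      = ∑ c : (j : {j // j ∈ L.toFinset}) → Fin (minimalPeriod σ j) → β,
          ∏ j : {j // j ∈ L.toFinset}, ∏ k : Fin (minimalPeriod σ j),
            x ((σ ^ (k : ℕ)) j) (c j k) (c j (k + 1)) := by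
        rw [← e.sum_comp]
        refine Finset.sum_congr rfl fun c _ => ?_
        simp_rw [← h.cycleEquiv.prod_comp, Fintype.prod_sigma, h.apply_cycleEquiv, e_apply,
          h.cycleEquiv_apply]
    _ = ∏ j : {j // j ∈ L.toFinset}, (((List.range (minimalPeriod σ j)).map
          fun k => x ((σ ^ k) j)).prod).trace := by
        simp_rw [trace_list_prod_map_range]
        rw [Finset.prod_univ_sum, Fintype.piFinset_univ]
    _ = _ := by
        rw [← List.prod_toFinset _ h.nodup]
        exact Finset.prod_coe_sort L.toFinset fun j =>
          (((List.range (minimalPeriod σ j)).map fun k => x ((σ ^ k) j)).prod).trace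

theorem IsCycleReps.cycleColouringCount_eq (h : IsCycleReps σ L) :
    cycleColouringCount σ = 2 ^ L.length := by
  have hcount : ∀ s : ι → Bool, (∏ k, (1 : Matrix Bool Bool ℤ) (s k) (s (σ k))) =
      if ∀ k, s (σ k) = s k then 1 else 0 := by
    intro s
    simp_rw [Matrix.one_apply, Finset.prod_ite_zero, Finset.mem_univ, forall_const, eq_comm,
      Finset.prod_const_one]
  have hsum := h.sum_prod_eq_prod_trace (R := ℤ) (β := Bool) fun _ => 1
  simp_rw [hcount, Finset.sum_boole] at hsum
  simp only [List.map_const', List.prod_replicate, one_pow, Matrix.trace_one,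
    Fintype.card_bool] at hsum
  exact_mod_cast hsum

end CycleReps

section InvertCycle

variable {ι : Type*}

theorem pow_apply_eq_of_forall_sameCycle {ρ τ : Perm ι} {x : ι}
    (h : ∀ y, ρ.SameCycle x y → τ y = ρ y) (k : ℕ) : (τ ^ k) x = (ρ ^ k) x := by
  induction k with
  | zero => rfl
  | succ k ih =>
    rw [pow_succ', pow_succ', Perm.mul_apply, Perm.mul_apply, ih, h _ Perm.SameCycle.rfl.pow_right]

theorem sameCycle_iff_of_forall_sameCycle [Finite ι] {ρ τ : Perm ι} {x : ι}
    (h : ∀ y, ρ.SameCycle x y → τ y = ρ y) (y : ι) : τ.SameCycle x y ↔ ρ.SameCycle x y := by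
  constructor
  · intro hτ
    obtain ⟨k, rfl⟩ := hτ.exists_nat_pow_eq
    rw [pow_apply_eq_of_forall_sameCycle h]
    exact Perm.SameCycle.rfl.pow_right
  · intro hρ
    obtain ⟨k, rfl⟩ := hρ.exists_nat_pow_eq
    rw [← pow_apply_eq_of_forall_sameCycle h]
    exact Perm.SameCycle.rfl.pow_right

variable [Fintype ι] [DecidableEq ι]

/-- The permutation obtained from `σ` by inverting its cycle through `m`. -/
def invertCycle (σ : Perm ι) (m : ι) : Perm ι :=
  σ * (σ.cycleOf m)⁻¹ * (σ.cycleOf m)⁻¹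

theorem sign_invertCycle (σ : Perm ι) (m : ι) : Perm.sign (invertCycle σ m) = Perm.sign σ := by
  rw [invertCycle, mul_assoc, Perm.sign_mul, Perm.sign_mul, Int.units_mul_self, mul_one]

theorem invertCycle_apply_of_sameCycle {σ : Perm ι} {m x : ι} (h : σ.SameCycle m x) :
    invertCycle σ m x = σ⁻¹ x := by
  simp [invertCycle, Perm.cycleOf_inv, Perm.cycleOf_apply, h]

theorem invertCycle_apply_of_not_sameCycle {σ : Perm ι} {m x : ι} (h : ¬ σ.SameCycle m x) :
    invertCycle σ m x = σ x := by
  simp [invertCycle, Perm.cycleOf_inv, Perm.cycleOf_apply, h]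

theorem pow_invertCycle_apply_of_sameCycle {σ : Perm ι} {m x : ι} (h : σ.SameCycle m x) (k : ℕ) :
    (invertCycle σ m ^ k) x = (σ⁻¹ ^ k) x :=
  pow_apply_eq_of_forall_sameCycle
    (fun _ hy => invertCycle_apply_of_sameCycle (h.trans (Perm.sameCycle_inv.1 hy))) k

theorem pow_invertCycle_apply_of_not_sameCycle {σ : Perm ι} {m x : ι} (h : ¬ σ.SameCycle m x)
    (k : ℕ) : (invertCycle σ m ^ k) x = (σ ^ k) x :=
  pow_apply_eq_of_forall_sameCycle
    (fun _ hy => invertCycle_apply_of_not_sameCycle fun hm => h (hm.trans hy.symm)) k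

theorem sameCycle_invertCycle (σ : Perm ι) (m x y : ι) :
    (invertCycle σ m).SameCycle x y ↔ σ.SameCycle x y := by
  by_cases h : σ.SameCycle m x
  · rw [← Perm.sameCycle_inv (f := σ)]
    exact sameCycle_iff_of_forall_sameCycle
      (fun _ hy => invertCycle_apply_of_sameCycle (h.trans (Perm.sameCycle_inv.1 hy))) y
  · exact sameCycle_iff_of_forall_sameCycle
      (fun _ hy => invertCycle_apply_of_not_sameCycle fun hm => h (hm.trans hy.symm)) y

theorem invertCycle_invertCycle (σ : Perm ι) (m : ι) : invertCycle (invertCycle σ m) m = σ := by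
  ext1 x
  by_cases h : σ.SameCycle m x
  · rw [invertCycle_apply_of_sameCycle ((sameCycle_invertCycle σ m m x).2 h), Perm.inv_eq_iff_eq,
      invertCycle_apply_of_sameCycle (Perm.sameCycle_apply_right.2 h), Perm.inv_def,
      Equiv.symm_apply_apply]
  · rw [invertCycle_apply_of_not_sameCycle (mt (sameCycle_invertCycle σ m m x).1 h),
      invertCycle_apply_of_not_sameCycle h]

end InvertCycle

section CycleProd

open Function (minimalPeriod)

theorem minimalPeriod_congr {α : Type*} {f g : α → α} {x : α} (h : ∀ k, g^[k] x = f^[k] x) :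
    minimalPeriod g x = minimalPeriod f x :=
  Function.minimalPeriod_eq_minimalPeriod_iff.2 fun k => by
    rw [Function.IsPeriodicPt, Function.IsPeriodicPt, Function.IsFixedPt, Function.IsFixedPt, h]

theorem minimalPeriod_inv {α : Type*} (σ : Perm α) (x : α) :
    minimalPeriod (σ⁻¹ : Perm α) x = minimalPeriod σ x :=
  Function.minimalPeriod_eq_minimalPeriod_iff.2 fun k => by
    rw [Function.IsPeriodicPt, Function.IsPeriodicPt, Perm.iterate_eq_pow, Perm.iterate_eq_pow,
      Function.IsFixedPt, Function.IsFixedPt, inv_pow, Perm.inv_eq_iff_eq, eq_comm]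

variable {R : Type*} [Ring R]

theorem cycleProd_congr (A : Matrix (Fin n) (Fin n) R) {σ τ : Perm (Fin n)} {j : Fin n}
    (h : ∀ k : ℕ, (τ ^ k) j = (σ ^ k) j) : cycleProd A τ j = cycleProd A σ j := by
  have hperiod : minimalPeriod τ j = minimalPeriod σ j :=
    minimalPeriod_congr fun k => by rw [Perm.iterate_eq_pow, Perm.iterate_eq_pow, h]
  simp only [cycleProd, h, hperiod]

theorem cycleProd_invertCycle_of_not_sameCycle (A : Matrix (Fin n) (Fin n) R)
    {σ : Perm (Fin n)} {m j : Fin n} (h : ¬ σ.SameCycle m j) :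
    cycleProd A (invertCycle σ m) j = cycleProd A σ j :=
  cycleProd_congr A (pow_invertCycle_apply_of_not_sameCycle h)

variable [StarRing R] {A : Matrix (Fin n) (Fin n) R}

theorem cycleProd_inv (hA : A.IsHermitian) (σ : Perm (Fin n)) (j : Fin n) :
    cycleProd A σ⁻¹ j = star (cycleProd A σ j) := by
  set p := minimalPeriod σ j with hp
  have inv_pow_apply : ∀ k ≤ p, (σ⁻¹ ^ k) j = (σ ^ (p - k)) j := by
    intro k hk
    rw [inv_pow, Perm.inv_eq_iff_eq, ← Perm.mul_apply, ← pow_add, Nat.add_sub_cancel' hk,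
      pow_minimalPeriod_apply]
  have star_prod : ∀ l : List R, star l.prod = (l.map star).reverse.prod :=
    unop_map_list_prod starMulEquiv
  rw [cycleProd, cycleProd, minimalPeriod_inv, ← hp, star_prod, ← List.map_reverse,
    ← List.map_reverse, List.range_eq_range', List.reverse_range', ← List.range_eq_range',
    List.map_map, List.map_map]
  refine congrArg List.prod (List.map_congr_left fun k hk => ?_)
  have hkp : k < p := List.mem_range.1 hk
  have reversed_index : 0 + p - 1 - k = p - (k + 1) := by lia
  have next_index : p - (k + 1) + 1 = p - k := by lia
  simp only [Function.comp_apply, hA.apply, reversed_index, next_index,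
    inv_pow_apply k hkp.le, inv_pow_apply (k + 1) hkp]

theorem cycleProd_invertCycle_self (hA : A.IsHermitian) (σ : Perm (Fin n)) (m : Fin n) :
    cycleProd A (invertCycle σ m) m = star (cycleProd A σ m) := by
  rw [← cycleProd_inv hA]
  exact cycleProd_congr A (pow_invertCycle_apply_of_sameCycle Perm.SameCycle.rfl)

end CycleProd

section CycleRepSystem

variable {ι : Type*}

/-- A choice of an ordered list of representatives of the cycles of every permutation that depends
only on the partition of `ι` into cycles. -/
structure IsCycleRepSystem (L : Perm ι → List ι) : Prop where
  isCycleReps : ∀ σ, IsCycleReps σ (L σ)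
  congr : ∀ {σ τ}, (∀ x y, τ.SameCycle x y ↔ σ.SameCycle x y) → L τ = L σ

theorem IsCycleRepSystem.reverse {L : Perm ι → List ι} (hL : IsCycleRepSystem L) :
    IsCycleRepSystem fun σ => (L σ).reverse where
  isCycleReps σ := (hL.isCycleReps σ).reverse
  congr h := congrArg List.reverse (hL.congr h)

theorem isCycleReps_cycleStarts (σ : Perm (Fin n)) (i : Fin n) :
    IsCycleReps σ (cycleStarts σ i) where
  nodup := by
    refine List.nodup_cons.2 ⟨fun h => ?_, (List.nodup_finRange n).filter _⟩
    exact (of_decide_eq_true (List.mem_filter.1 h).2).1 Perm.SameCycle.rfl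
  eq_of_sameCycle := by
    intro j k hj hk h
    simp only [cycleStarts, List.mem_cons, List.mem_filter, List.mem_finRange, true_and,
      decide_eq_true_eq] at hj hk
    rcases hj with rfl | ⟨hij, hj⟩ <;> rcases hk with rfl | ⟨hik, hk⟩
    · rfl
    · exact absurd h hik
    · exact absurd h.symm hij
    · exact le_antisymm (hj k h) (hk j h.symm)
  exists_sameCycle := by
    intro x
    by_cases hx : σ.SameCycle i x
    · exact ⟨i, List.mem_cons_self, hx⟩
    · obtain ⟨j, hj, hmin⟩ := Set.exists_min_image {j | σ.SameCycle x j} id (Set.toFinite _)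
        ⟨x, Perm.SameCycle.rfl⟩
      refine ⟨j, List.mem_cons_of_mem _ (List.mem_filter.2 ⟨List.mem_finRange j, ?_⟩), hj.symm⟩
      exact decide_eq_true ⟨fun h => hx (h.trans hj.symm), fun k hk => hmin k (hj.trans hk)⟩

theorem isCycleRepSystem_cycleStarts (i : Fin n) :
    IsCycleRepSystem fun σ : Perm (Fin n) => cycleStarts σ i where
  isCycleReps σ := isCycleReps_cycleStarts σ i
  congr h := by simp only [cycleStarts, h]

open Function (update)

variable {R : Type*} [Ring R]

theorem prod_map_update_add [DecidableEq ι] {l : List ι} {m : ι} (hl : l.Nodup) (hm : m ∈ l)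
    (f : ι → R) (a b : R) : (l.map (update f m (a + b))).prod =
      (l.map (update f m a)).prod + (l.map (update f m b)).prod := by
  obtain ⟨l₁, l₂, rfl⟩ := List.append_of_mem hm
  obtain ⟨hm₁, hm₂⟩ : m ∉ l₁ ∧ m ∉ l₂ := by
    simpa [not_or] using (List.nodup_cons.1 (List.nodup_middle.1 hl)).1
  have map_update : ∀ {l : List ι}, m ∉ l → ∀ c, l.map (update f m c) = l.map f := fun h c =>
    List.map_congr_left fun j hj => Function.update_of_ne (ne_of_mem_of_not_mem hj h) c f
  simp only [List.map_append, List.map_cons, List.prod_append, List.prod_cons, map_update hm₁,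
    map_update hm₂, Function.update_self, add_mul, mul_add]

variable [IsAddTorsionFree R] {L : Perm ι → List ι}

theorem IsCycleRepSystem.sum_sign_mul_prod_update [Fintype ι] [DecidableEq ι]
    (hL : IsCycleRepSystem L) (m : ι) {f : Perm ι → ι → R} {c : Perm ι → R}
    (hoff : ∀ σ j, ¬ σ.SameCycle m j → f (invertCycle σ m) j = f σ j)
    (hadd : ∀ σ, f σ m + f (invertCycle σ m) m = 2 • c σ) :
    ∑ σ, ((Perm.sign σ : ℤ) : R) * ((L σ).map (update (f σ) m (c σ))).prod =
      ∑ σ, ((Perm.sign σ : ℤ) : R) * ((L σ).map (f σ)).prod := by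
  -- The involution inverting the cycle through `m` pairs the summands; a pair adds up to twice the
  -- summand in which `c σ` replaces the factor at `m`.
  have hL_invert : ∀ σ, L (invertCycle σ m) = L σ :=
    fun σ => hL.congr (sameCycle_invertCycle σ m)
  let φ (σ : Perm ι) : Perm ι := if m ∈ L σ then invertCycle σ m else σ
  have hφ : Function.Involutive φ := by
    intro σ
    by_cases h : m ∈ L σ <;> simp [φ, h, hL_invert, invertCycle_invertCycle]
  let g (σ : Perm ι) : R := ((Perm.sign σ : ℤ) : R) * ((L σ).map (f σ)).prod
  have pair : ∀ σ, g σ + g (φ σ) =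
      2 • (((Perm.sign σ : ℤ) : R) * ((L σ).map (update (f σ) m (c σ))).prod) := by
    intro σ
    by_cases h : m ∈ L σ
    · have hmap : (L σ).map (f (invertCycle σ m)) =
          (L σ).map (update (f σ) m (f (invertCycle σ m) m)) := by
        refine List.map_congr_left fun j hj => ?_
        obtain rfl | hjm := eq_or_ne j m
        · rw [Function.update_self]
        · rw [Function.update_of_ne hjm]
          exact hoff σ j fun hmj => hjm ((hL.isCycleReps σ).eq_of_sameCycle h hj hmj).symm
      have hprod := prod_map_update_add (hL.isCycleReps σ).nodup h (f σ)
      simp only [g, φ, if_pos h, sign_invertCycle, hL_invert, hmap]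
      nth_rw 1 [← Function.update_eq_self m (f σ)]
      rw [← mul_add, ← hprod, hadd, two_nsmul, hprod, mul_add, two_nsmul]
    · have hmap : (L σ).map (update (f σ) m (c σ)) = (L σ).map (f σ) :=
        List.map_congr_left fun j hj => Function.update_of_ne (ne_of_mem_of_not_mem hj h) _ _
      simp only [g, φ, if_neg h, hmap, two_nsmul]
  refine nsmul_right_injective two_ne_zero ?_
  calc 2 • ∑ σ, ((Perm.sign σ : ℤ) : R) * ((L σ).map (update (f σ) m (c σ))).prod
      = ∑ σ, g σ + ∑ σ, g (φ σ) := by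
        rw [Finset.smul_sum, ← Finset.sum_add_distrib]
        exact Finset.sum_congr rfl fun σ _ => (pair σ).symm
    _ = 2 • ∑ σ, g σ := by
        rw [two_nsmul]
        exact congrArg _ (Equiv.sum_comp hφ.toPerm g)

theorem IsCycleRepSystem.sum_sign_mul_prod_cycleProd [StarRing R] {L : Perm (Fin n) → List (Fin n)}
    (hL : IsCycleRepSystem L) {A : Matrix (Fin n) (Fin n) R} (hA : A.IsHermitian) {t : R → R}
    (ht : ∀ a, a + star a = 2 • t a) :
    ∑ σ, ((Perm.sign σ : ℤ) : R) * ((L σ).map (cycleProd A σ)).prod =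
      ∑ σ, ((Perm.sign σ : ℤ) : R) * ((L σ).map fun j => t (cycleProd A σ j)).prod := by
  let x (T : Finset (Fin n)) (σ : Perm (Fin n)) : Fin n → R :=
    T.piecewise (fun j => t (cycleProd A σ j)) (cycleProd A σ)
  suffices partial_replacement : ∀ T,
      ∑ σ, ((Perm.sign σ : ℤ) : R) * ((L σ).map (x T σ)).prod =
        ∑ σ, ((Perm.sign σ : ℤ) : R) * ((L σ).map (cycleProd A σ)).prod by
    simpa only [x, Finset.piecewise_univ] using (partial_replacement Finset.univ).symm
  intro T
  induction T using Finset.induction_on with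
  | empty => simp only [x, Finset.piecewise_empty]
  | insert m T hm ih =>
    rw [← ih]
    simp only [x, Finset.piecewise_insert]
    refine hL.sum_sign_mul_prod_update m (fun σ j hj => ?_) fun σ => ?_
    · simp only [Finset.piecewise, cycleProd_invertCycle_of_not_sameCycle A hj]
    · rw [Finset.piecewise_eq_of_notMem _ _ _ hm, Finset.piecewise_eq_of_notMem _ _ _ hm,
        cycleProd_invertCycle_self hA, ht]

end CycleRepSystem

section Quaternion

open Quaternion ComplexConjugate

/-- The representation of the quaternions by complex two-by-two matrices, which sends `z + w * j`
with complex `z` and `w` to `!![z, w; -conj w, conj z]`. The index `false` is the first one. -/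
noncomputable def quatToMatrix : ℍ[ℝ] →+* Matrix Bool Bool ℂ where
  toFun q := Matrix.of fun a b =>
    match a, b with
    | false, false => ⟨q.re, q.imI⟩
    | false, true => ⟨q.imJ, q.imK⟩
    | true, false => ⟨-q.imJ, q.imK⟩
    | true, true => ⟨q.re, -q.imI⟩
  map_zero' := by
    ext a b; cases a <;> cases b <;> apply Complex.ext <;> simp
  map_one' := by
    ext a b; cases a <;> cases b <;> apply Complex.ext <;> simp
  map_add' p q := by
    ext a b; cases a <;> cases b <;> apply Complex.ext <;> simp <;> ring
  map_mul' p q := by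
    ext a b; cases a <;> cases b <;> apply Complex.ext <;> simp [Matrix.mul_apply] <;> ring

theorem trace_quatToMatrix (q : ℍ[ℝ]) : (quatToMatrix q).trace = ((2 * q.re : ℝ) : ℂ) := by
  apply Complex.ext <;> simp [quatToMatrix, Matrix.trace, two_mul]

theorem quatToMatrix_star (q : ℍ[ℝ]) :
    quatToMatrix (star q) = (quatToMatrix q).conjTranspose := by
  ext a b; cases a <;> cases b <;> apply Complex.ext <;> simp [quatToMatrix]

theorem quatToMatrix_star_apply_not (q : ℍ[ℝ]) (a b : Bool) :
    (if b then 1 else -1) * quatToMatrix (star q) a (!b) =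
      (if a then -1 else 1) * quatToMatrix q b (!a) := by
  cases a <;> cases b <;> apply Complex.ext <;> simp [quatToMatrix]

variable {ι : Type*} [Fintype ι] [DecidableEq ι]

/-- The complex matrix of a quaternion matrix, with every entry replaced by its two-by-two block
`quatToMatrix`. -/
noncomputable def toComplexMatrix : Matrix ι ι ℍ[ℝ] →+* Matrix (ι × Bool) (ι × Bool) ℂ :=
  (Matrix.compRingEquiv ι Bool ℂ).toRingHom.comp quatToMatrix.mapMatrix

theorem toComplexMatrix_apply (A : Matrix ι ι ℍ[ℝ]) (x y : ι × Bool) :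
    toComplexMatrix A x y = quatToMatrix (A x.1 y.1) x.2 y.2 := rfl

theorem toComplexMatrix_conjTranspose (A : Matrix ι ι ℍ[ℝ]) :
    toComplexMatrix A.conjTranspose = (toComplexMatrix A).conjTranspose := by
  ext1 x y
  simp only [toComplexMatrix_apply, Matrix.conjTranspose_apply, quatToMatrix_star]

theorem toComplexMatrix_conjTranspose_mul_symplecticMatrix (A : Matrix ι ι ℍ[ℝ]) :
    toComplexMatrix A.conjTranspose * symplecticMatrix ι ℂ =
      symplecticMatrix ι ℂ * (toComplexMatrix A).transpose := by
  ext1 x y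
  rw [mul_symplecticMatrix_apply, symplecticMatrix_mul_apply, Matrix.transpose_apply]
  exact quatToMatrix_star_apply_not _ _ _

theorem transpose_toComplexMatrix_mul_symplecticMatrix {H : Matrix ι ι ℍ[ℝ]}
    (hH : H.IsHermitian) : (toComplexMatrix H * symplecticMatrix ι ℂ).transpose =
      -(toComplexMatrix H * symplecticMatrix ι ℂ) := by
  nth_rw 2 [← hH.eq]
  rw [toComplexMatrix_conjTranspose_mul_symplecticMatrix, Matrix.transpose_mul,
    transpose_symplecticMatrix, Matrix.neg_mul]

theorem det_toComplexMatrix_conjTranspose (A : Matrix ι ι ℍ[ℝ]) :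
    (toComplexMatrix A.conjTranspose).det = (toComplexMatrix A).det := by
  refine (isUnit_det_symplecticMatrix (ι := ι) (R := ℂ)).mul_right_cancel ?_
  rw [← Matrix.det_mul, toComplexMatrix_conjTranspose_mul_symplecticMatrix, Matrix.det_mul,
    Matrix.det_transpose, mul_comm]

/-- The Study determinant of a quaternion matrix. The complex determinant is in fact real, see
`ofReal_studyDet`. -/
noncomputable def studyDet (A : Matrix ι ι ℍ[ℝ]) : ℝ :=
  (toComplexMatrix A).det.re

theorem ofReal_studyDet (A : Matrix ι ι ℍ[ℝ]) : (studyDet A : ℂ) = (toComplexMatrix A).det := by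
  refine Complex.conj_eq_iff_re.1 ?_
  rw [starRingEnd_apply, ← Matrix.det_conjTranspose, ← toComplexMatrix_conjTranspose,
    det_toComplexMatrix_conjTranspose]

theorem studyDet_mul (A B : Matrix ι ι ℍ[ℝ]) : studyDet (A * B) = studyDet A * studyDet B := by
  rw [← Complex.ofReal_inj, Complex.ofReal_mul, ofReal_studyDet, ofReal_studyDet, ofReal_studyDet,
    map_mul, Matrix.det_mul]

theorem studyDet_conjTranspose (A : Matrix ι ι ℍ[ℝ]) : studyDet A.conjTranspose = studyDet A := by
  rw [studyDet, studyDet, det_toComplexMatrix_conjTranspose]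

theorem halfTraceDet_toComplexMatrix_mul_mul_conjTranspose (A : Matrix ι ι ℍ[ℝ])
    {H : Matrix ι ι ℍ[ℝ]} (hH : H.IsHermitian) :
    halfTraceDet (toComplexMatrix (A * H * A.conjTranspose)) =
      (toComplexMatrix A).det * halfTraceDet (toComplexMatrix H) := by
  have hpfaffian : ∀ {H : Matrix ι ι ℍ[ℝ]}, H.IsHermitian →
      scaledPfaffian (toComplexMatrix H * symplecticMatrix ι ℂ) =
        (Fintype.card ((ι → Bool) × Perm ι) : ℂ) * halfTraceDet (toComplexMatrix H) :=
    fun hH => scaledPfaffian_mul_symplecticMatrix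
      (transpose_toComplexMatrix_mul_symplecticMatrix hH)
  have hcongruence : toComplexMatrix (A * H * A.conjTranspose) * symplecticMatrix ι ℂ =
      toComplexMatrix A * (toComplexMatrix H * symplecticMatrix ι ℂ) *
        (toComplexMatrix A).transpose := by
    rw [map_mul, map_mul, mul_assoc, toComplexMatrix_conjTranspose_mul_symplecticMatrix]
    simp only [mul_assoc]
  have hcard : (Fintype.card ((ι → Bool) × Perm ι) : ℂ) ≠ 0 :=
    Nat.cast_ne_zero.2 Fintype.card_ne_zero
  refine mul_left_cancel₀ hcard ?_
  rw [← hpfaffian (Matrix.isHermitian_mul_mul_conjTranspose A hH), hcongruence,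
    scaledPfaffian_mul_mul_transpose, hpfaffian hH, mul_left_comm]

theorem halfTraceDet_toComplexMatrix_mul_conjTranspose_self (A : Matrix ι ι ℍ[ℝ]) :
    halfTraceDet (toComplexMatrix (A * A.conjTranspose)) = studyDet A := by
  have h := halfTraceDet_toComplexMatrix_mul_mul_conjTranspose A Matrix.isHermitian_one
  rwa [mul_one, map_one, halfTraceDet_one, mul_one, ← ofReal_studyDet] at h

theorem IsCycleReps.sum_prod_toComplexMatrix {σ : Perm (Fin n)} {L : List (Fin n)}
    (h : IsCycleReps σ L) (H : Matrix (Fin n) (Fin n) ℍ[ℝ]) :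
    ∑ s : Fin n → Bool, ∏ k, toComplexMatrix H (k, s k) (σ k, s (σ k)) =
      cycleColouringCount σ * (L.map fun j => ((cycleProd H σ j).re : ℂ)).prod := by
  have trace_cycle : ∀ j, (((List.range (Function.minimalPeriod σ j)).map
      fun k => quatToMatrix (H ((σ ^ k) j) (σ ((σ ^ k) j)))).prod).trace =
        2 * ((cycleProd H σ j).re : ℂ) := by
    intro j
    rw [cycleProd, ← Complex.ofReal_ofNat, ← Complex.ofReal_mul, ← trace_quatToMatrix,
      map_list_prod, List.map_map]
    simp only [Function.comp_def, pow_succ', Perm.mul_apply]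
  simp_rw [toComplexMatrix_apply]
  rw [h.sum_prod_eq_prod_trace fun k => quatToMatrix (H k (σ k))]
  simp_rw [trace_cycle]
  rw [List.prod_map_mul, List.map_const', List.prod_replicate, h.cycleColouringCount_eq,
    Nat.cast_pow, Nat.cast_ofNat]

theorem IsCycleReps.cycleColouringCount_ne_zero {σ : Perm ι} {L : List ι} (h : IsCycleReps σ L) :
    cycleColouringCount σ ≠ 0 := by
  rw [h.cycleColouringCount_eq]
  exact pow_ne_zero _ two_ne_zero

theorem IsCycleRepSystem.halfTraceDet_toComplexMatrix {L : Perm (Fin n) → List (Fin n)}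
    (hL : IsCycleRepSystem L) (H : Matrix (Fin n) (Fin n) ℍ[ℝ]) :
    halfTraceDet (toComplexMatrix H) =
      ((∑ σ, (Perm.sign σ : ℤ) * ((L σ).map fun j => (cycleProd H σ j).re).prod : ℝ) : ℂ) := by
  rw [halfTraceDet, Complex.ofReal_sum]
  refine Finset.sum_congr rfl fun σ _ => ?_
  have hcount : (cycleColouringCount σ : ℂ) ≠ 0 :=
    Nat.cast_ne_zero.2 (hL.isCycleReps σ).cycleColouringCount_ne_zero
  rw [(hL.isCycleReps σ).sum_prod_toComplexMatrix H, mul_assoc, inv_mul_cancel_left₀ hcount,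
    Complex.ofReal_mul, Complex.ofReal_intCast, ← Complex.ofRealHom_eq_coe, map_list_prod,
    List.map_map]
  rfl

theorem IsCycleRepSystem.sum_sign_mul_prod_eq_coe {L : Perm (Fin n) → List (Fin n)}
    (hL : IsCycleRepSystem L) {H : Matrix (Fin n) (Fin n) ℍ[ℝ]} (hH : H.IsHermitian) {r : ℝ}
    (hr : halfTraceDet (toComplexMatrix H) = r) :
    ∑ σ, ((Perm.sign σ : ℤ) : ℍ[ℝ]) * ((L σ).map (cycleProd H σ)).prod = r := by
  have : IsAddTorsionFree ℍ[ℝ] := .of_isTorsionFree ℝ ℍ[ℝ]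
  rw [hL.halfTraceDet_toComplexMatrix, Complex.ofReal_inj] at hr
  rw [hL.sum_sign_mul_prod_cycleProd hH (t := fun q => ((q.re : ℝ) : ℍ[ℝ]))
      fun q => by rw [Quaternion.self_add_star, two_nsmul, two_mul],
    ← hr, ← Quaternion.algebraMap_def, map_sum]
  refine Finset.sum_congr rfl fun σ _ => ?_
  rw [map_mul, map_intCast, map_list_prod, List.map_map]
  rfl

theorem rdet_mul_conjTranspose_self (i : Fin n) (A : Matrix (Fin n) (Fin n) ℍ[ℝ]) :
    rdet i (A * A.conjTranspose) = studyDet A :=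
  (isCycleRepSystem_cycleStarts i).sum_sign_mul_prod_eq_coe
    (Matrix.isHermitian_mul_conjTranspose_self A)
    (halfTraceDet_toComplexMatrix_mul_conjTranspose_self A)

theorem cdet_mul_conjTranspose_self (j : Fin n) (A : Matrix (Fin n) (Fin n) ℍ[ℝ]) :
    cdet j (A * A.conjTranspose) = studyDet A :=
  (isCycleRepSystem_cycleStarts j).reverse.sum_sign_mul_prod_eq_coe
    (Matrix.isHermitian_mul_conjTranspose_self A)
    (halfTraceDet_toComplexMatrix_mul_conjTranspose_self A)

theorem rdet_conjTranspose_mul_self (i : Fin n) (A : Matrix (Fin n) (Fin n) ℍ[ℝ]) :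
    rdet i (A.conjTranspose * A) = studyDet A := by
  rw [← studyDet_conjTranspose, ← rdet_mul_conjTranspose_self i, Matrix.conjTranspose_conjTranspose]

theorem cdet_conjTranspose_mul_self (j : Fin n) (A : Matrix (Fin n) (Fin n) ℍ[ℝ]) :
    cdet j (A.conjTranspose * A) = studyDet A := by
  rw [← studyDet_conjTranspose, ← cdet_mul_conjTranspose_self j, Matrix.conjTranspose_conjTranspose]

theorem ddet_eq_studyDet [NeZero n] (A : Matrix (Fin n) (Fin n) ℍ[ℝ]) : ddet A = studyDet A :=
  rdet_mul_conjTranspose_self 0 A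

end Quaternion

end RowColDet

/-- The double determinant over the real Hamilton quaternions is well defined (every row and
column determinant of `A A*` and of `A* A` gives the same value) and multiplicative. -/
theorem mainTheorem6 (n : ℕ) [NeZero n] :
    (∀ (A : Matrix (Fin n) (Fin n) (Quaternion ℝ)) (i : Fin n),
      RowColDet.rdet i (A * A.conjTranspose) = RowColDet.ddet A ∧
      RowColDet.cdet i (A * A.conjTranspose) = RowColDet.ddet A ∧
      RowColDet.rdet i (A.conjTranspose * A) = RowColDet.ddet A ∧
      RowColDet.cdet i (A.conjTranspose * A) = RowColDet.ddet A) ∧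
    ∀ A B : Matrix (Fin n) (Fin n) (Quaternion ℝ),
      RowColDet.ddet (A * B) = RowColDet.ddet A * RowColDet.ddet B := by
  simp only [RowColDet.ddet_eq_studyDet]
  exact ⟨fun A i => ⟨RowColDet.rdet_mul_conjTranspose_self i A,
      RowColDet.cdet_mul_conjTranspose_self i A, RowColDet.rdet_conjTranspose_mul_self i A,
      RowColDet.cdet_conjTranspose_mul_self i A⟩,
    fun A B => by rw [RowColDet.studyDet_mul, Quaternion.coe_mul]⟩
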